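/- **Setting.** Fix a set $\mathscr P$ of participants and a set $\mathbb A$ of message labels. *Actions* $\ell$ are $pq!a$ ($p$ sends $a$ to $q$) and $pq?a$ ($q$ receives $a$ from $p$), with $\mathrm{subj}(pq!a)=p$ and $\mathrm{subj}(pq?a)=q$. *Global types* are given by $G ::= p\to p':\{a_j.G_j\}_{j\in J}\mid \mu t.G\mid t\mid \mathsf{end}$, up to renaming of bound type variables, where $J$ is finite and nonempty, the labels $a_j$ are pairwise distinct, $p\neq p'$, and recursion is guarded (in $\mu t.G$ the variable $t$ occurs in $G$ only under communications $p\to p'$). *Local types* are $T ::= p?\{a_i.T_i\}_{i\in I}\mid p!\{a_i.T_i\}_{i\in I}\mid\mu t.T\mid t\mid\mathsf{end}$, with distinct labels; the order of the branches is immaterial. A type may have free type variables; they have no transitions. *Projection* $G{\upharpoonright}r$ is the partial operation with $t{\upharpoonright}r=t$, $\mathsf{end}{\upharpoonright}r=\mathsf{end}$; $(\mu t.G){\upharpoonright}r=\mu t.(G{\upharpoonright}r)$ if $G{\upharpoonright}r\ne t$ and $\mathsf{end}$ if $G{\upharpoonright}r=t$; and $(p\to p':\{a_j.G_j\}_{j\in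 J}){\upharpoonright}r$ equal to $p'!\{a_j.(G_j{\upharpoonright}r)\}_{j\in J}$ if $r=p$, to $p?\{a_j.(G_j{\upharpoonright}r)\}_{j\in J}$ if $r=p'$, and to $\bigsqcup_{j\in J}(G_j{\upharpoonright}r)$ otherwise. Here $\sqcup$ is the partial merge of local types: for branchings on the same participant, index the branches by their labels and set $$p?\{a.T_a\}_{a\in K}\sqcup p?\{a.T'_a\}_{a\in J}=p?\big(\{a.(T_a\sqcup T'_a)\}_{a\in K\cap J}\cup\{a.T_a\}_{a\in K\setminus J}\cup\{a.T'_a\}_{a\in J\setminus K}\big);$$ otherwise $\sqcup$ is homomorphic: $\mathsf{end}\sqcup\mathsf{end}=\mathsf{end}$, $t\sqcup t=t$, $\mu t.T\sqcup\mu t.T'=\mu t.(T\sqcup T')$, $p!\{a.T_a\}_{a\in I}\sqcup p!\{a.T'_a\}_{a\in I}=p!\{a.(T_a\sqcup T'_a)\}_{a\in I}$, and it is undefined in all other cases. *LTS of global types.* Add the intermediate construct $p\rightsquigarrow p':j\,\{a_i.G_i\}_{i\in I}$ ($j\in I$; the message $a_j$ is sent but not yet received). Transitions $G\xrightarrow{\ell}G'$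 are generated by: - (GR1) $p\to p':\{a_i.G_i\}_{i\in I}\xrightarrow{pp'!a_j}p\rightsquigarrow p':j\,\{a_i.G_i\}_{i\in I}$ for $j\in I$; - (GR2) $p\rightsquigarrow p':j\,\{a_i.G_i\}_{i\in I}\xrightarrow{pp'?a_j}G_j$; - (GR3) $\mu t.G\xrightarrow{\ell}G'$ if $G[\mu t.G/t]\xrightarrow{\ell}G'$; - (GR4) $p\to q:\{a_i.G_i\}_{i\in I}\xrightarrow{\ell}p\to q:\{a_i.G'_i\}_{i\in I}$ if $G_i\xrightarrow{\ell}G'_i$ for all $i\in I$ and $p,q\neq\mathrm{subj}(\ell)$; - (GR5) $p\rightsquigarrow q:j\,\{a_i.G_i\}_{i\in I}\xrightarrow{\ell}p\rightsquigarrow q:j\,\{a_i.G'_i\}_{i\in I}$ if $G_j\xrightarrow{\ell}G'_j$, $q\neq\mathrm{subj}(\ell)$ and $G'_i=G_i$ for $i\neq j$. *LTS of local types of role $p$:* $q!\{a_i.T_i\}_{i\in I}\xrightarrow{pq!a_j}T_j$ and $q?\{a_i.T_i\}_{i\in I}\xrightarrow{qp?a_j}T_j$ for $j\in I$; and $\mu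 t.T\xrightarrow{\ell}T'$ if $T[\mu t.T/t]\xrightarrow{\ell}T'$. *LTS of configurations.* A configuration is $(\vec T;\vec w)$ with a local type $T_p$ for each $p\in\mathscr P$ and a finite word $w_{pq}\in\mathbb A^*$ for each channel $pq$, $p\ne q$. There is a transition $(\vec T;\vec w)\xrightarrow{pq!a}(\vec T';\vec w')$ if $T_p\xrightarrow{pq!a}T'_p$ and $w'_{pq}=w_{pq}\cdot a$, and a transition $(\vec T;\vec w)\xrightarrow{pq?a}(\vec T';\vec w')$ if $T_q\xrightarrow{pq?a}T'_q$ and $w_{pq}=a\cdot w'_{pq}$; in both cases all other components are unchanged. The *traces* of a state are the finite words of actions labelling the finite transition sequences that start from it, and $\approx$ means having the same set of traces. **Theorem (soundness and completeness).** Let $G$ be a global type whose projection $G{\upharpoonright}p$ is defined for every $p\in\mathscr P$, and let $\vec T=\{G{\upharpoonright}p\}_{p\in\mathscr P}$. Then $G\approx(\vec T;\vec\epsilon)$, where $\vec\epsilon$ denotes the configuration with all buffers empty: for every finite word $\varphi$ of actions, $\varphi$ is a trace of $G$ if and only if $\varphi$ is a trace of $(\vec T;\vec\epsilon)$. -/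

import Mathlib

/-- Observable actions over participants `P` and message labels `A`:
`send p q a` is `pq!a` (`p` puts `a` on the channel from `p` to `q`), and
`recv p q a` is `pq?a` (`q` takes `a` from the channel from `p` to `q`). -/
inductive CommAction (P : Type*) (A : Type*) where
  | send (p q : P) (a : A) : CommAction P A
  | recv (p q : P) (a : A) : CommAction P A

/-- The subject of an action: the sender of `pq!a` is `p`, the receiver of `pq?a` is `q`. -/
def CommAction.subj {P A : Type*} : CommAction P A → P
  | .send p _ _ => p
  | .recv _ q _ => q

/-- Raw global types, together with the intermediate construct of the labelled transition system.
Type variables are de Bruijn indices (`mu` binds index `0`), so that types are taken up to renaming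
of bound variables. The branches are indexed by their pairwise distinct labels.
* `comm p q I G` is `p → q : {a. G a}_{a ∈ I}`;
* `transit p q I j G` is `p ⇝ q : j {a. G a}_{a ∈ I}`: the message `j` is sent, not yet received. -/
inductive GType (P : Type*) (A : Type*) where
  | ended : GType P A
  | var (n : ℕ) : GType P A
  | mu (G : GType P A) : GType P A
  | comm (p q : P) (I : Finset A) (G : {a // a ∈ I} → GType P A) : GType P A
  | transit (p q : P) (I : Finset A) (j : {a // a ∈ I}) (G : {a // a ∈ I} → GType P A) : GType P A

/-- Local types, with de Bruijn indices for type variables.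
* `send q I T` is the selection `q!{a. T a}_{a ∈ I}`;
* `recv q I T` is the branching `q?{a. T a}_{a ∈ I}`. -/
inductive LType (P : Type*) (A : Type*) where
  | ended : LType P A
  | var (n : ℕ) : LType P A
  | mu (T : LType P A) : LType P A
  | send (q : P) (I : Finset A) (T : {a // a ∈ I} → LType P A) : LType P A
  | recv (q : P) (I : Finset A) (T : {a // a ∈ I} → LType P A) : LType P A

namespace GType

variable {P A : Type*}

/-- Increase by one every variable with index at least `k`. -/
def shift (k : ℕ) : GType P A → GType P A
  | ended => ended
  | var n => if n < k then var n else var (n + 1)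
  | mu G => mu (shift (k + 1) G)
  | comm p q I G => comm p q I (fun i => shift k (G i))
  | transit p q I j G => transit p q I j (fun i => shift k (G i))

/-- Capture-avoiding substitution of `X` for the variable `k`, whose binder is removed. -/
def subst (k : ℕ) (X : GType P A) : GType P A → GType P A
  | ended => ended
  | var n => if n < k then var n else if n = k then X else var (n - 1)
  | mu G => mu (subst (k + 1) (shift 0 X) G)
  | comm p q I G => comm p q I (fun i => subst k X (G i))
  | transit p q I j G => transit p q I j (fun i => subst k X (G i))

/-- The variable `k` occurs only under communications. -/
def Guarded (k : ℕ) : GType P A → Prop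
  | ended => True
  | var n => n ≠ k
  | mu G => Guarded (k + 1) G
  | comm _ _ _ _ => True
  | transit _ _ _ _ _ => True

/-- Global types proper: no intermediate construct, no message from a participant to itself, at
least one branch in each communication, and every recursion variable guarded. -/
inductive IsGlobal : GType P A → Prop
  | ended : IsGlobal ended
  | var (n : ℕ) : IsGlobal (var n)
  | mu {G : GType P A} (hG : IsGlobal G) (hg : Guarded 0 G) : IsGlobal (mu G)
  | comm {p q : P} {I : Finset A} {G : {a // a ∈ I} → GType P A} (hpq : p ≠ q) (hI : I.Nonempty)
      (hG : ∀ i, IsGlobal (G i)) : IsGlobal (comm p q I G)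

/-- The labelled transition system over global types. -/
inductive Step : GType P A → CommAction P A → GType P A → Prop
  | gr1 (p q : P) (I : Finset A) (G : {a // a ∈ I} → GType P A) (j : {a // a ∈ I}) :
      Step (comm p q I G) (.send p q j.1) (transit p q I j G)
  | gr2 (p q : P) (I : Finset A) (j : {a // a ∈ I}) (G : {a // a ∈ I} → GType P A) :
      Step (transit p q I j G) (.recv p q j.1) (G j)
  | gr3 {G G' : GType P A} {l : CommAction P A} (h : Step (subst 0 (mu G) G) l G') :
      Step (mu G) l G'
  | gr4 {p q : P} {I : Finset A} {G G' : {a // a ∈ I} → GType P A} {l : CommAction P A}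
      (h : ∀ j, Step (G j) l (G' j)) (hp : p ≠ l.subj) (hq : q ≠ l.subj) :
      Step (comm p q I G) l (comm p q I G')
  | gr5 {p q : P} {I : Finset A} {j : {a // a ∈ I}} {G G' : {a // a ∈ I} → GType P A}
      {l : CommAction P A} (h : Step (G j) l (G' j)) (hq : q ≠ l.subj)
      (hG : ∀ i, i ≠ j → G' i = G i) :
      Step (transit p q I j G) l (transit p q I j G')

end GType

namespace LType

variable {P A : Type*}

/-- Increase by one every variable with index at least `k`. -/
def shift (k : ℕ) : LType P A → LType P A
  | ended => ended
  | var n => if n < k then var n else var (n + 1)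
  | mu T => mu (shift (k + 1) T)
  | send q I T => send q I (fun i => shift k (T i))
  | recv q I T => recv q I (fun i => shift k (T i))

/-- Capture-avoiding substitution of `X` for the variable `k`, whose binder is removed. -/
def subst (k : ℕ) (X : LType P A) : LType P A → LType P A
  | ended => ended
  | var n => if n < k then var n else if n = k then X else var (n - 1)
  | mu T => mu (subst (k + 1) (shift 0 X) T)
  | send q I T => send q I (fun i => subst k X (T i))
  | recv q I T => recv q I (fun i => subst k X (T i))

/-- The labelled transition system over local types of role `p`. -/
inductive Step (p : P) : LType P A → CommAction P A → LType P A → Prop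
  | lr1 (q : P) (I : Finset A) (T : {a // a ∈ I} → LType P A) (j : {a // a ∈ I}) :
      Step p (send q I T) (.send p q j.1) (T j)
  | lr2 (q : P) (I : Finset A) (T : {a // a ∈ I} → LType P A) (j : {a // a ∈ I}) :
      Step p (recv q I T) (.recv q p j.1) (T j)
  | lr3 {T T' : LType P A} {l : CommAction P A} (h : Step p (subst 0 (mu T) T) l T') :
      Step p (mu T) l T'

/-- `Merge S T U` says that `S ⊔ T` is defined and equal to `U`: two branchings on the same sender
are merged by taking the union of their label sets and merging the continuations of the common
labels, and `⊔` is homomorphic for the other constructors. -/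
inductive Merge : LType P A → LType P A → LType P A → Prop
  | ended : Merge ended ended ended
  | var (n : ℕ) : Merge (var n) (var n) (var n)
  | mu {S T U : LType P A} (h : Merge S T U) : Merge (mu S) (mu T) (mu U)
  | send {q : P} {I : Finset A} {S T U : {a // a ∈ I} → LType P A}
      (h : ∀ i, Merge (S i) (T i) (U i)) : Merge (send q I S) (send q I T) (send q I U)
  | recv {q : P} {K J L : Finset A} {S : {a // a ∈ K} → LType P A}
      {T : {a // a ∈ J} → LType P A} {U : {a // a ∈ L} → LType P A}
      (hL : ∀ a, a ∈ L ↔ a ∈ K ∨ a ∈ J)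
      (hKJ : ∀ a (hK : a ∈ K) (hJ : a ∈ J) (hL : a ∈ L), Merge (S ⟨a, hK⟩) (T ⟨a, hJ⟩) (U ⟨a, hL⟩))
      (hK : ∀ a (hK : a ∈ K) (hL : a ∈ L), a ∉ J → U ⟨a, hL⟩ = S ⟨a, hK⟩)
      (hJ : ∀ a (hJ : a ∈ J) (hL : a ∈ L), a ∉ K → U ⟨a, hL⟩ = T ⟨a, hJ⟩) :
      Merge (recv q K S) (recv q J T) (recv q L U)

/-- `MergeList [T₁, …, Tₙ] U` says that `T₁ ⊔ (⋯ ⊔ Tₙ)` is defined and equal to `U` (`n ≥ 1`). -/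
inductive MergeList : List (LType P A) → LType P A → Prop
  | singleton (T : LType P A) : MergeList [T] T
  | cons {S T U : LType P A} {Ts : List (LType P A)} (hT : MergeList Ts T) (hU : Merge S T U) :
      MergeList (S :: Ts) U

/-- `MergeFamily T U` says that `⊔_{a ∈ I} T a` is defined and equal to `U`. -/
def MergeFamily {I : Finset A} (T : {a // a ∈ I} → LType P A) (U : LType P A) : Prop :=
  ∃ e : List {a // a ∈ I}, e.Nodup ∧ (∀ i, i ∈ e) ∧ MergeList (e.map T) U

end LType

/-- `Proj G r T` says that the projection of the global type `G` onto `r` is defined and equal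
to `T`. -/
inductive Proj {P A : Type*} : GType P A → P → LType P A → Prop
  | ended (r : P) : Proj .ended r .ended
  | var (n : ℕ) (r : P) : Proj (.var n) r (.var n)
  | mu {G : GType P A} {r : P} {T : LType P A} (h : Proj G r T) (hT : T ≠ .var 0) :
      Proj (.mu G) r (.mu T)
  | mu_ended {G : GType P A} {r : P} (h : Proj G r (.var 0)) : Proj (.mu G) r .ended
  | sender {p q : P} {I : Finset A} {G : {a // a ∈ I} → GType P A} {T : {a // a ∈ I} → LType P A}
      (h : ∀ i, Proj (G i) p (T i)) : Proj (.comm p q I G) p (.send q I T)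
  | receiver {p q : P} {I : Finset A} {G : {a // a ∈ I} → GType P A} {T : {a // a ∈ I} → LType P A}
      (hpq : q ≠ p) (h : ∀ i, Proj (G i) q (T i)) : Proj (.comm p q I G) q (.recv p I T)
  | other {p q r : P} {I : Finset A} {G : {a // a ∈ I} → GType P A}
      {T : {a // a ∈ I} → LType P A} {U : LType P A} (hp : r ≠ p) (hq : r ≠ q)
      (h : ∀ i, Proj (G i) r (T i)) (hU : LType.MergeFamily T U) : Proj (.comm p q I G) r U

/-- Configurations of a system of local types: one local type for each participant, and one FIFO
buffer `buf p q` for each channel `pq` (the diagonal entries `buf p p` play no role). -/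
structure Config (P : Type*) (A : Type*) where
  types : P → LType P A
  buf : P → P → List A

/-- The labelled transition system over configurations. -/
inductive Config.Step {P A : Type*} : Config P A → CommAction P A → Config P A → Prop
  | send {s s' : Config P A} {p q : P} {a : A}
      (h : LType.Step p (s.types p) (.send p q a) (s'.types p))
      (ht : ∀ r, r ≠ p → s'.types r = s.types r)
      (hw : s'.buf p q = s.buf p q ++ [a])
      (hb : ∀ r t, (r, t) ≠ (p, q) → s'.buf r t = s.buf r t) :
      Config.Step s (.send p q a) s'
  | recv {s s' : Config P A} {p q : P} {a : A}
      (h : LType.Step q (s.types q) (.recv p q a) (s'.types q))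
      (ht : ∀ r, r ≠ q → s'.types r = s.types r)
      (hw : s.buf p q = a :: s'.buf p q)
      (hb : ∀ r t, (r, t) ≠ (p, q) → s'.buf r t = s.buf r t) :
      Config.Step s (.recv p q a) s'

/-- `Run step s φ s'` says that `s` reaches `s'` by a finite sequence of transitions whose
successive labels form the word `φ`. -/
inductive Run {S L : Type*} (step : S → L → S → Prop) : S → List L → S → Prop
  | nil (s : S) : Run step s [] s
  | cons {s t u : S} {l : L} {φ : List L} (h : step s l t) (hr : Run step t φ u) :
      Run step s (l :: φ) u

/-- The set of finite traces of the state `s` of a labelled transition system. -/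
def traces {S L : Type*} (step : S → L → S → Prop) (s : S) : Set (List L) :=
  {φ | ∃ s', Run step s φ s'}

/-! `Implements G s` is a bisimulation. It says that each local type of `s` is a projection of `G`
up to unfolding and extra input branches (`RunProj`), and that the buffers hold exactly the messages
of the intermediate constructs of `G`, outermost first on each channel (`Queues`).

From `G` to `s`: a transition is matched by the type of its subject (`RunProj.exists_step`) and by
the buffers (`Queues.exists_bufStep`), while all other types stay valid unchanged
(`RunProj.step_of_ne`). Since a configuration has at most one successor for each label, the converse
only needs that `G` can perform every label that `s` can.

For a send, the subject's type shows a selection before any variable or `ended`, so every branch of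
`G` reaches that communication before a recursion variable, and finitely many rules derive the
transition. For a receive, the message at the head of the buffer points to an intermediate construct
that nothing blocks.

Of merging, only one fact is kept: a merge lies above its arguments in the order `Sub`. Extra input
branches are harmless, because the label received is dictated by the queue. -/

namespace LType

variable {P A : Type*}

/-! ### Unfolding and determinism of local types -/

/-- `Unfolds T U` says that `U` is obtained from `T` by unfolding outermost recursions. -/
inductive Unfolds : LType P A → LType P A → Prop
  | refl (T : LType P A) : Unfolds T T
  | mu {T U : LType P A} (h : Unfolds (subst 0 (mu T) T) U) : Unfolds (mu T) U

theorem Step.of_unfolds {p : P} {T U V : LType P A} {l : CommAction P A} (h : Unfolds T U)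
    (hs : Step p U l V) : Step p T l V := by
  induction h with
  | refl => exact hs
  | mu _ ih => exact .lr3 (ih hs)

theorem Step.unfolds {p : P} {T U V : LType P A} {l : CommAction P A} (h : Unfolds T U)
    (hs : Step p T l V) : Step p U l V := by
  induction h with
  | refl => exact hs
  | mu _ ih => cases hs with | lr3 hs => exact ih hs

theorem Step.deterministic {p : P} {T U V : LType P A} {l : CommAction P A} (hU : Step p T l U)
    (hV : Step p T l V) : U = V := by
  induction hU with
  | lr1 q I T j =>
    generalize hl : CommAction.send p q j.1 = l at hV
    cases hV with
    | lr1 _ _ _ i =>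
      injection hl with _ _ h
      rw [Subtype.ext h]
  | lr2 q I T j =>
    generalize hl : CommAction.recv q p j.1 = l at hV
    cases hV with
    | lr2 _ _ _ i =>
      injection hl with _ _ h
      rw [Subtype.ext h]
  | lr3 _ ih => cases hV with | lr3 hV => exact ih hV

/-! ### Merging as an upper bound for input extension -/

/-- The order in which `S` is below every type obtained from it by adding branches to inputs. -/
inductive Sub : LType P A → LType P A → Prop
  | ended : Sub ended ended
  | var (n : ℕ) : Sub (var n) (var n)
  | mu {S T : LType P A} (h : Sub S T) : Sub (mu S) (mu T)
  | send {q : P} {I : Finset A} {S T : {a // a ∈ I} → LType P A} (h : ∀ i, Sub (S i) (T i)) :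
      Sub (send q I S) (send q I T)
  | recv {q : P} {K L : Finset A} {S : {a // a ∈ K} → LType P A} {T : {a // a ∈ L} → LType P A}
      (hKL : K ⊆ L) (h : ∀ i : {a // a ∈ K}, Sub (S i) (T ⟨i.1, hKL i.2⟩)) :
      Sub (recv q K S) (recv q L T)

theorem Sub.refl (T : LType P A) : Sub T T := by
  induction T with
  | ended => exact .ended
  | var n => exact .var n
  | mu _ ih => exact .mu ih
  | send _ _ _ ih => exact .send ih
  | recv _ _ _ ih => exact .recv (Finset.Subset.refl _) ih

theorem Merge.sub {S T U : LType P A} (h : Merge S T U) : Sub S U ∧ Sub T U := by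
  induction h with
  | ended => exact ⟨.ended, .ended⟩
  | var n => exact ⟨.var n, .var n⟩
  | mu _ ih => exact ⟨.mu ih.1, .mu ih.2⟩
  | send _ ih => exact ⟨.send fun i => (ih i).1, .send fun i => (ih i).2⟩
  | @recv q K J L S T U hL hKJ hK hJ ih =>
    have hKL : K ⊆ L := fun a ha => (hL a).2 (.inl ha)
    have hJL : J ⊆ L := fun a ha => (hL a).2 (.inr ha)
    refine ⟨.recv hKL ?_, .recv hJL ?_⟩
    · rintro ⟨a, ha⟩
      by_cases haJ : a ∈ J
      · exact (ih a ha haJ (hKL ha)).1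
      · rw [hK a ha (hKL ha) haJ]
        exact .refl _
    · rintro ⟨a, ha⟩
      by_cases haK : a ∈ K
      · exact (ih a haK ha (hJL ha)).2
      · rw [hJ a ha (hJL ha) haK]
        exact .refl _

/-! ### Selections visible without unfolding -/

/-- `HeadSend T q I`: below its outermost recursions, `T` is a selection towards `q` with
labels `I`. -/
inductive HeadSend : LType P A → P → Finset A → Prop
  | send (q : P) (I : Finset A) (T : {a // a ∈ I} → LType P A) : HeadSend (send q I T) q I
  | mu {T : LType P A} {q : P} {I : Finset A} (h : HeadSend T q I) : HeadSend (mu T) q I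

theorem HeadSend.of_shift {T : LType P A} {q : P} {I : Finset A} {k : ℕ}
    (h : HeadSend (shift k T) q I) : HeadSend T q I := by
  induction T generalizing k with
  | ended => cases h
  | var n =>
    simp only [shift] at h
    split at h <;> cases h
  | mu T ih => cases h with | mu h => exact .mu (ih h)
  | send p J T _ =>
    simp only [shift] at h
    cases h
    exact .send _ _ _
  | recv _ _ _ _ => cases h

theorem HeadSend.of_subst {X T : LType P A} {q : P} {I : Finset A} {k : ℕ}
    (h : HeadSend (subst k X T) q I) : HeadSend T q I ∨ HeadSend X q I := by
  induction T generalizing k X with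
  | ended => cases h
  | var n =>
    simp only [subst] at h
    split at h
    · cases h
    split at h
    · exact .inr h
    · cases h
  | mu T ih => cases h with | mu h => exact (ih h).imp .mu .of_shift
  | send p J T _ =>
    simp only [subst] at h
    cases h
    exact .inl (.send _ _ _)
  | recv _ _ _ _ => cases h

/-- Unfolding creates no new head: a selection at the head of `T[μT]` comes either from `T` or from
the substituted `μT`, and in both cases `μT` already shows it. -/
theorem Step.headSend {p p' q : P} {a : A} {T U : LType P A} (h : Step p T (.send p' q a) U) :
    ∃ I, a ∈ I ∧ HeadSend T q I := by
  generalize hl : CommAction.send p' q a = l at h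
  induction h with
  | lr1 _ I T j =>
    injection hl with _ hq ha
    subst hq ha
    exact ⟨I, j.2, .send _ _ _⟩
  | lr2 => cases hl
  | lr3 _ ih =>
    obtain ⟨I, ha, h⟩ := ih hl
    exact ⟨I, ha, h.of_subst.elim .mu id⟩

/-- The side condition of `WeakProj.mu` survives substitution under the binder: the shifted `X`
avoids index `0`, and the only indices lowered exceed `k + 1`. -/
theorem subst_ne_var_zero {T X : LType P A} {k : ℕ} (hT : T ≠ var 0) :
    subst (k + 1) (shift 0 X) T ≠ var 0 := by
  cases T with
  | var n =>
    simp only [subst]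
    split
    · exact hT
    split
    · cases X <;> simp [shift]
    · intro h
      injection h with h
      omega
  | _ => simp [subst]

end LType

/-! ### Projection up to extra input branches -/

/-- `WeakProj G r T`: the local type `T` of `r` has the behaviour prescribed by the global type `G`,
up to additional branches in inputs. -/
inductive WeakProj {P A : Type*} : GType P A → P → LType P A → Prop
  | ended (r : P) : WeakProj .ended r .ended
  | var (n : ℕ) (r : P) : WeakProj (.var n) r (.var n)
  | mu {G : GType P A} {r : P} {T : LType P A} (h : WeakProj G r T) (hT : T ≠ .var 0) :
      WeakProj (.mu G) r (.mu T)
  | mu_ended {G : GType P A} {r : P} (h : WeakProj G r (.var 0)) : WeakProj (.mu G) r .ended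
  | sender {p q : P} {I : Finset A} {G : {a // a ∈ I} → GType P A} {T : {a // a ∈ I} → LType P A}
      (h : ∀ i, WeakProj (G i) p (T i)) : WeakProj (.comm p q I G) p (.send q I T)
  | receiver {p q : P} {I L : Finset A} {G : {a // a ∈ I} → GType P A}
      {T : {a // a ∈ L} → LType P A} (hpq : q ≠ p) (hL : I ⊆ L)
      (h : ∀ i : {a // a ∈ I}, WeakProj (G i) q (T ⟨i.1, hL i.2⟩)) :
      WeakProj (.comm p q I G) q (.recv p L T)
  | other {p q r : P} {I : Finset A} {G : {a // a ∈ I} → GType P A} {T : LType P A} (hp : r ≠ p)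
      (hq : r ≠ q) (h : ∀ i, WeakProj (G i) r T) : WeakProj (.comm p q I G) r T

namespace WeakProj

variable {P A : Type*}

theorem of_sub {G : GType P A} {r : P} {S T : LType P A} (h : WeakProj G r S)
    (hST : S.Sub T) : WeakProj G r T := by
  induction h generalizing T with
  | ended r => cases hST; exact .ended r
  | var n r => cases hST; exact .var n r
  | mu _ hT ih =>
    cases hST with
    | mu hST =>
      refine .mu (ih hST) ?_
      rintro rfl
      cases hST
      exact hT rfl
  | mu_ended h _ => cases hST; exact .mu_ended h
  | sender _ ih => cases hST with | send hST => exact .sender fun i => ih i (hST i)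
  | receiver hpq hL _ ih =>
    cases hST with
    | recv hKL hST => exact .receiver hpq (hL.trans hKL) fun i => ih i (hST _)
  | other hp hq _ ih => exact .other hp hq fun i => ih i hST

/-- This lets one type, the merge, serve all branches at once, as `WeakProj.other` demands. -/
theorem of_mergeList {Ts : List (LType P A)} {U : LType P A} (h : LType.MergeList Ts U) :
    ∀ T ∈ Ts, ∀ (G : GType P A) (r : P), WeakProj G r T → WeakProj G r U := by
  induction h with
  | singleton T =>
    intro S hS G r h
    rwa [← List.mem_singleton.1 hS]
  | cons _ hU ih =>
    intro S hS G r h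
    rcases List.mem_cons.1 hS with rfl | hS
    · exact h.of_sub hU.sub.1
    · exact (ih S hS G r h).of_sub hU.sub.2

theorem of_proj {G : GType P A} {r : P} {T : LType P A} (h : Proj G r T) : WeakProj G r T := by
  induction h with
  | ended r => exact .ended r
  | var n r => exact .var n r
  | mu _ hT ih => exact .mu ih hT
  | mu_ended _ ih => exact .mu_ended ih
  | sender _ ih => exact .sender ih
  | receiver hpq _ ih => exact .receiver hpq (Finset.Subset.refl _) ih
  | other hp hq _ hU ih =>
    obtain ⟨e, -, he, hU⟩ := hU
    exact .other hp hq fun i => of_mergeList hU _ (List.mem_map_of_mem (he i)) _ _ (ih i)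

theorem shift {G : GType P A} {r : P} {T : LType P A} (h : WeakProj G r T) (k : ℕ) :
    WeakProj (G.shift k) r (T.shift k) := by
  induction h generalizing k with
  | ended r => exact .ended r
  | var n r =>
    simp only [GType.shift, LType.shift]
    split <;> exact .var _ r
  | @mu G r T _ hT ih =>
    refine .mu (ih (k + 1)) ?_
    cases T with
    | var n =>
      simp only [LType.shift]
      split
      · exact hT
      · simp
    | _ => simp [LType.shift]
  | mu_ended _ ih =>
    refine .mu_ended ?_
    simpa [LType.shift] using ih (k + 1)
  | sender _ ih => exact .sender fun i => ih i k
  | receiver hpq hL _ ih => exact .receiver hpq hL fun i => ih i k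
  | other hp hq _ ih => exact .other hp hq fun i => ih i k

theorem subst {G X : GType P A} {r : P} {T Y : LType P A} (h : WeakProj G r T)
    (hX : WeakProj X r Y) (k : ℕ) : WeakProj (GType.subst k X G) r (LType.subst k Y T) := by
  induction h generalizing k X Y with
  | ended r => exact .ended r
  | var n r =>
    simp only [GType.subst, LType.subst]
    split
    · exact .var _ r
    split
    · exact hX
    · exact .var _ r
  | mu _ hT ih => exact .mu (ih (hX.shift 0) (k + 1)) (LType.subst_ne_var_zero hT)
  | mu_ended _ ih =>
    refine .mu_ended ?_
    simpa [LType.subst] using ih (hX.shift 0) (k + 1)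
  | sender _ ih => exact .sender fun i => ih i hX k
  | receiver hpq hL _ ih => exact .receiver hpq hL fun i => ih i hX k
  | other hp hq _ ih => exact .other hp hq fun i => ih i hX k

end WeakProj

/-! ### Static global types and substitution instances -/

namespace GType

variable {P A : Type*}

/-- Global types without intermediate construct, self-communication or empty choice. -/
inductive IsStatic : GType P A → Prop
  | ended : IsStatic ended
  | var (n : ℕ) : IsStatic (var n)
  | mu {G : GType P A} (hG : IsStatic G) : IsStatic (mu G)
  | comm {p q : P} {I : Finset A} {G : {a // a ∈ I} → GType P A} (hpq : p ≠ q) (hI : I.Nonempty)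
      (hG : ∀ i, IsStatic (G i)) : IsStatic (comm p q I G)

theorem IsGlobal.isStatic {G : GType P A} (h : IsGlobal G) : IsStatic G := by
  induction h with
  | ended => exact .ended
  | var n => exact .var n
  | mu _ _ ih => exact .mu ih
  | comm hpq hI _ ih => exact .comm hpq hI ih

theorem IsStatic.shift {G : GType P A} (h : IsStatic G) (k : ℕ) : IsStatic (G.shift k) := by
  induction h generalizing k with
  | ended => exact .ended
  | var n =>
    simp only [GType.shift]
    split <;> exact .var _
  | mu _ ih => exact .mu (ih _)
  | comm hpq hI _ ih => exact .comm hpq hI fun i => ih i k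

theorem IsStatic.subst {G X : GType P A} (h : IsStatic G) (hX : IsStatic X) (k : ℕ) :
    IsStatic (GType.subst k X G) := by
  induction h generalizing k X with
  | ended => exact .ended
  | var n =>
    simp only [GType.subst]
    split
    · exact .var _
    split
    · exact hX
    · exact .var _
  | mu _ ih => exact .mu (ih (hX.shift 0) _)
  | comm hpq hI _ ih => exact .comm hpq hI fun i => ih i hX k

/-- `Instance G H`: `H` is obtained from `G` by successive substitutions. -/
inductive Instance (G : GType P A) : GType P A → Prop
  | refl : Instance G G
  | subst {H : GType P A} (h : Instance G H) (k : ℕ) (X : GType P A) : Instance G (GType.subst k X H)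

theorem Instance.mu_inv {G H : GType P A} (h : Instance (mu G) H) :
    ∃ G', H = mu G' ∧ Instance G G' := by
  induction h with
  | refl => exact ⟨G, rfl, .refl⟩
  | subst _ k X ih =>
    obtain ⟨G', rfl, h⟩ := ih
    exact ⟨_, rfl, h.subst _ _⟩

theorem Instance.comm_inv {p q : P} {I : Finset A} {G : {a // a ∈ I} → GType P A} {H : GType P A}
    (h : Instance (comm p q I G) H) : ∃ G', H = comm p q I G' ∧ ∀ i, Instance (G i) (G' i) := by
  induction h with
  | refl => exact ⟨G, rfl, fun _ => .refl⟩
  | subst _ k X ih =>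
    obtain ⟨G', rfl, h⟩ := ih
    exact ⟨_, rfl, fun i => (h i).subst _ _⟩

end GType

/-- A derivation for a type headed by a selection never ends at a variable or at `ended`, so each
path through `G` meets the send before a recursion variable. What has been substituted for the
variables is therefore irrelevant, and induction on the derivation for `G` yields the step for every
instance `H`. -/
theorem WeakProj.exists_step_send {P A : Type*} {G H : GType P A} {p q : P} {T : LType P A}
    {I : Finset A} {a : A} (h : WeakProj G p T) (hT : T.HeadSend q I) (ha : a ∈ I)
    (hH : G.Instance H) : ∃ H', H.Step (.send p q a) H' := by
  induction h generalizing H with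
  | ended | var | mu_ended | receiver => cases hT
  | mu _ _ ih =>
    cases hT with
    | mu hT =>
      obtain ⟨G', rfl, hG'⟩ := hH.mu_inv
      -- The unfolded body is again an instance of the original body, so no larger derivation is
      -- needed.
      obtain ⟨H', h⟩ := ih hT (hG'.subst 0 (.mu G'))
      exact ⟨H', .gr3 h⟩
  | sender _ _ =>
    cases hT
    obtain ⟨G', rfl, -⟩ := hH.comm_inv
    exact ⟨_, .gr1 _ _ _ _ ⟨a, ha⟩⟩
  | other hp hq _ ih =>
    obtain ⟨G', rfl, hG'⟩ := hH.comm_inv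
    choose H' h using fun i => ih i hT (hG' i)
    exact ⟨_, .gr4 h hp.symm hq.symm⟩

/-! ### Projection of run-time states -/

/-- Extension of `WeakProj` to the states reached by global types. -/
inductive RunProj {P A : Type*} : GType P A → P → LType P A → Prop
  | weak {G : GType P A} {r : P} {T : LType P A} (h : WeakProj G r T) : RunProj G r T
  | unfold {G : GType P A} {r : P} {T : LType P A} (h : RunProj G r (.subst 0 (.mu T) T)) :
      RunProj G r (.mu T)
  | sender {p q : P} {I : Finset A} {G : {a // a ∈ I} → GType P A} {T : {a // a ∈ I} → LType P A}
      (h : ∀ i, RunProj (G i) p (T i)) : RunProj (.comm p q I G) p (.send q I T)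
  | receiver {p q : P} {I L : Finset A} {G : {a // a ∈ I} → GType P A}
      {T : {a // a ∈ L} → LType P A} (hpq : q ≠ p) (hL : I ⊆ L)
      (h : ∀ i : {a // a ∈ I}, RunProj (G i) q (T ⟨i.1, hL i.2⟩)) :
      RunProj (.comm p q I G) q (.recv p L T)
  | other {p q r : P} {I : Finset A} {G : {a // a ∈ I} → GType P A} {T : LType P A} (hp : r ≠ p)
      (hq : r ≠ q) (h : ∀ i, RunProj (G i) r T) : RunProj (.comm p q I G) r T
  | transit_receiver {p q : P} {I L : Finset A} {j : {a // a ∈ I}} {G : {a // a ∈ I} → GType P A}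
      {T : {a // a ∈ L} → LType P A} (hj : j.1 ∈ L) (h : RunProj (G j) q (T ⟨j.1, hj⟩)) :
      RunProj (.transit p q I j G) q (.recv p L T)
  | transit_other {p q r : P} {I : Finset A} {j : {a // a ∈ I}} {G : {a // a ∈ I} → GType P A}
      {T : LType P A} (hq : r ≠ q) (h : RunProj (G j) r T) : RunProj (.transit p q I j G) r T

namespace RunProj

variable {P A : Type*} {p q r : P} {I : Finset A} {j : {a // a ∈ I}}
  {G : {a // a ∈ I} → GType P A} {T U : LType P A}

theorem of_unfolds {H : GType P A} (hTU : T.Unfolds U) (h : RunProj H r U) : RunProj H r T := by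
  induction hTU with
  | refl => exact h
  | mu _ ih => exact .unfold (ih h)

/-- Idle participants keep their types while the global recursion unfolds, so the type may still be
folded and its head appears only after `Unfolds`. -/
theorem sender_inv (h : RunProj (.comm p q I G) p U) :
    ∃ T, U.Unfolds (.send q I T) ∧ ∀ i, RunProj (G i) p (T i) := by
  generalize hH : GType.comm p q I G = H at h
  generalize hr : p = r at h
  induction h with
  | weak h =>
    subst hH hr
    cases h with
    | sender h => exact ⟨_, .refl _, fun i => .weak (h i)⟩
    | receiver hpq => exact absurd rfl hpq
    | other hp => exact absurd rfl hp
  | unfold _ ih =>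
    obtain ⟨T, hT, h⟩ := ih hH hr
    exact ⟨T, .mu hT, h⟩
  | sender h => cases hH; exact ⟨_, .refl _, h⟩
  | receiver hpq => cases hH; exact absurd hr.symm hpq
  | other hp => cases hH; exact absurd hr.symm hp
  | transit_receiver | transit_other => cases hH

theorem receiver_inv (hpq : q ≠ p) (h : RunProj (.comm p q I G) q U) :
    ∃ (L : Finset A) (T : {a // a ∈ L} → LType P A) (hL : I ⊆ L), U.Unfolds (.recv p L T) ∧
      ∀ i : {a // a ∈ I}, RunProj (G i) q (T ⟨i.1, hL i.2⟩) := by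
  generalize hH : GType.comm p q I G = H at h
  generalize hr : q = r at h
  induction h with
  | weak h =>
    subst hH hr
    cases h with
    | sender h => exact absurd rfl hpq
    | receiver hpq hL h => exact ⟨_, _, hL, .refl _, fun i => .weak (h i)⟩
    | other _ hq => exact absurd rfl hq
  | unfold _ ih =>
    obtain ⟨L, T, hL, hT, h⟩ := ih hH hr
    exact ⟨L, T, hL, .mu hT, h⟩
  | sender h => cases hH; exact absurd hr hpq
  | receiver hpq hL h => cases hH; exact ⟨_, _, hL, .refl _, h⟩
  | other _ hq => cases hH; exact absurd hr.symm hq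
  | transit_receiver | transit_other => cases hH

theorem other_inv (hp : r ≠ p) (hq : r ≠ q) (h : RunProj (.comm p q I G) r U) (i : {a // a ∈ I}) :
    RunProj (G i) r U := by
  generalize hH : GType.comm p q I G = H at h
  induction h with
  | weak h =>
    subst hH
    cases h with
    | sender h => exact absurd rfl hp
    | receiver => exact absurd rfl hq
    | other _ _ h => exact .weak (h i)
  | unfold _ ih => exact .unfold (ih hp hq hH)
  | sender h => cases hH; exact absurd rfl hp
  | receiver => cases hH; exact absurd rfl hq
  | other _ _ h => cases hH; exact h i
  | transit_receiver | transit_other => cases hH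

theorem transit_receiver_inv (h : RunProj (.transit p q I j G) q U) :
    ∃ (L : Finset A) (T : {a // a ∈ L} → LType P A) (hj : j.1 ∈ L), U.Unfolds (.recv p L T) ∧
      RunProj (G j) q (T ⟨j.1, hj⟩) := by
  generalize hH : GType.transit p q I j G = H at h
  generalize hr : q = r at h
  induction h with
  | weak h => subst hH; cases h
  | unfold _ ih =>
    obtain ⟨L, T, hj, hT, h⟩ := ih hH hr
    exact ⟨L, T, hj, .mu hT, h⟩
  | sender | receiver | other => cases hH
  | transit_receiver hj h => cases hH; exact ⟨_, _, hj, .refl _, h⟩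
  | transit_other hq => cases hH; exact absurd hr.symm hq

theorem transit_other_inv (hq : r ≠ q) (h : RunProj (.transit p q I j G) r U) :
    RunProj (G j) r U := by
  generalize hH : GType.transit p q I j G = H at h
  induction h with
  | weak h => subst hH; cases h
  | unfold _ ih => exact .unfold (ih hq hH)
  | sender | receiver | other => cases hH
  | transit_receiver => cases hH; exact absurd rfl hq
  | transit_other _ h => cases hH; exact h

/-- `WeakProj` commutes with substitution, which relates the unfolded global type to the unfolded
local one; `RunProj.unfold` then restores the folded local type. -/
theorem unfold_global {H : GType P A} (h : RunProj (.mu H) r U) :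
    RunProj (GType.subst 0 (.mu H) H) r U := by
  generalize hK : GType.mu H = K at h ⊢
  induction h with
  | weak h =>
    subst hK
    cases h with
    | mu h hT => exact .unfold (.weak (h.subst (.mu h hT) 0))
    | mu_ended h => exact .weak (by simpa [LType.subst] using h.subst (.mu_ended h) 0)
  | unfold _ ih => exact .unfold (ih hK)
  | sender | receiver | other | transit_receiver | transit_other => cases hK

/-- A global transition leaves the types of the participants other than its subject valid. -/
theorem step_of_ne {H H' : GType P A} {l : CommAction P A} (hs : H.Step l H') (hr : r ≠ l.subj)
    (h : RunProj H r T) : RunProj H' r T := by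
  induction hs generalizing T with
  | gr1 p q I G j =>
    by_cases hq : r = q
    · subst hq
      obtain ⟨L, S, hL, hT, h⟩ := h.receiver_inv hr
      -- The receiver keeps its whole branching, of which only the continuation for the chosen label
      -- still has to be valid.
      exact .of_unfolds hT (.transit_receiver (hL j.2) (h j))
    · exact .transit_other hq (h.other_inv hr hq j)
  | gr2 p q I j G => exact h.transit_other_inv hr
  | gr3 _ ih => exact ih hr h.unfold_global
  | @gr4 p q I G G' l _ hp hq ih =>
    by_cases hrp : r = p
    · subst hrp
      obtain ⟨S, hT, h⟩ := h.sender_inv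
      exact .of_unfolds hT (.sender fun i => ih i hr (h i))
    by_cases hrq : r = q
    · subst hrq
      obtain ⟨L, S, hL, hT, h⟩ := h.receiver_inv hrp
      exact .of_unfolds hT (.receiver hrp hL fun i => ih i hr (h i))
    · exact .other hrp hrq fun i => ih i hr (h.other_inv hrp hrq i)
  | @gr5 p q I j G G' l _ hq _ ih =>
    by_cases hrq : r = q
    · subst hrq
      obtain ⟨L, S, hj, hT, h⟩ := h.transit_receiver_inv
      exact .of_unfolds hT (.transit_receiver hj (ih hr h))
    · exact .transit_other hrq (ih hr (h.transit_other_inv hrq))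

theorem exists_step_send {H : GType P A} {a : A} (h : RunProj H p T)
    (hT : T.Step p (.send p q a) U) : ∃ H', H.Step (.send p q a) H' := by
  classical
  induction h with
  | weak h =>
    obtain ⟨I, ha, hI⟩ := hT.headSend
    exact h.exists_step_send hI ha .refl
  | unfold _ ih => cases hT with | lr3 hT => exact ih hT
  | sender h => cases hT with | lr1 _ _ _ j => exact ⟨_, .gr1 _ _ _ _ j⟩
  | receiver | transit_receiver => cases hT
  | other hp hq _ ih =>
    choose H' h using fun i => ih i hT
    exact ⟨_, .gr4 h hp.symm hq.symm⟩
  | @transit_other _ _ _ I j G T hq _ ih =>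
    obtain ⟨H', h⟩ := ih hT
    -- (GR5) moves only the branch `j` and leaves the others as they are.
    exact ⟨_, .gr5 (G' := Function.update G j H') (by simpa using h) hq.symm
      fun i hi => by simp [hi]⟩

end RunProj

/-! ### Buffers and determinism of configurations -/

/-- The effect of an action on the buffers. -/
inductive BufStep {P A : Type*} :
    (P → P → List A) → CommAction P A → (P → P → List A) → Prop
  | send {w w' : P → P → List A} {p q : P} {a : A} (hw : w' p q = w p q ++ [a])
      (hb : ∀ r t, (r, t) ≠ (p, q) → w' r t = w r t) : BufStep w (.send p q a) w'
  | recv {w w' : P → P → List A} {p q : P} {a : A} (hw : w p q = a :: w' p q)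
      (hb : ∀ r t, (r, t) ≠ (p, q) → w' r t = w r t) : BufStep w (.recv p q a) w'

theorem BufStep.deterministic {P A : Type*} {w u v : P → P → List A} {l : CommAction P A}
    (hu : BufStep w l u) (hv : BufStep w l v) : u = v := by
  funext r t
  cases hu with
  | @send _ p q a hw hb =>
    cases hv with
    | send hw' hb' =>
      by_cases h : (r, t) = (p, q)
      · cases h
        rw [hw, hw']
      · rw [hb r t h, hb' r t h]
  | @recv _ p q a hw hb =>
    cases hv with
    | recv hw' hb' =>
      by_cases h : (r, t) = (p, q)
      · cases h
        exact (List.cons.inj (hw.symm.trans hw')).2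
      · rw [hb r t h, hb' r t h]

theorem BufStep.apply_of_ne {P A : Type*} {w w' : P → P → List A} {l : CommAction P A} {p q : P}
    (h : BufStep w l w') (hp : p ≠ l.subj) (hq : q ≠ l.subj) : w' p q = w p q := by
  cases h with
  | send _ hb => exact hb _ _ fun h => hp (Prod.ext_iff.1 h).1
  | recv _ hb => exact hb _ _ fun h => hq (Prod.ext_iff.1 h).2

theorem Config.step_iff {P A : Type*} {s s' : Config P A} {l : CommAction P A} :
    Config.Step s l s' ↔ LType.Step l.subj (s.types l.subj) l (s'.types l.subj) ∧
      (∀ r, r ≠ l.subj → s'.types r = s.types r) ∧ BufStep s.buf l s'.buf := by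
  constructor
  · rintro (⟨h, ht, hw, hb⟩ | ⟨h, ht, hw, hb⟩)
    · exact ⟨h, ht, .send hw hb⟩
    · exact ⟨h, ht, .recv hw hb⟩
  · obtain ⟨T, w⟩ := s
    obtain ⟨T', w'⟩ := s'
    rintro ⟨h, ht, hw⟩
    cases hw with
    | send hw hb => exact .send h ht hw hb
    | recv hw hb => exact .recv h ht hw hb

theorem Config.Step.deterministic {P A : Type*} {s t u : Config P A} {l : CommAction P A}
    (ht : Config.Step s l t) (hu : Config.Step s l u) : t = u := by
  obtain ⟨ht₁, ht₂, ht₃⟩ := Config.step_iff.1 ht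
  obtain ⟨hu₁, hu₂, hu₃⟩ := Config.step_iff.1 hu
  obtain ⟨T, w⟩ := t
  obtain ⟨U, v⟩ := u
  congr 1
  · funext r
    by_cases hr : r = l.subj
    · subst hr
      exact ht₁.deterministic hu₁
    · exact (ht₂ r hr).trans (hu₂ r hr).symm
  · exact ht₃.deterministic hu₃

/-! ### Messages in transit -/

/-- `Queues G w`: the well-formed global state `G` has the messages `w` in transit. -/
inductive Queues {P A : Type*} : GType P A → (P → P → List A) → Prop
  | static {G : GType P A} (hG : G.IsStatic) : Queues G fun _ _ => []
  | comm {p q : P} {I : Finset A} {G : {a // a ∈ I} → GType P A} {w : P → P → List A}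
      (hpq : p ≠ q) (hI : I.Nonempty) (hw : w p q = []) (h : ∀ i, Queues (G i) w) :
      Queues (.comm p q I G) w
  | transit {p q : P} {I : Finset A} {j : {a // a ∈ I}} {G : {a // a ∈ I} → GType P A}
      {w w' : P → P → List A} (hpq : p ≠ q) (hw : w' p q = j.1 :: w p q)
      (hb : ∀ r t, (r, t) ≠ (p, q) → w' r t = w r t) (h : Queues (G j) w) :
      Queues (.transit p q I j G) w'

namespace Queues

variable {P A : Type*} {p q : P} {I : Finset A} {j : {a // a ∈ I}}
  {G : {a // a ∈ I} → GType P A} {w : P → P → List A}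

theorem comm_inv (h : Queues (.comm p q I G) w) :
    p ≠ q ∧ I.Nonempty ∧ w p q = [] ∧ ∀ i, Queues (G i) w := by
  cases h with
  | static hG => cases hG with | comm hpq hI hG => exact ⟨hpq, hI, rfl, fun i => .static (hG i)⟩
  | comm hpq hI hw h => exact ⟨hpq, hI, hw, h⟩

theorem transit_inv (h : Queues (.transit p q I j G) w) :
    p ≠ q ∧ ∃ v, w p q = j.1 :: v p q ∧ (∀ r t, (r, t) ≠ (p, q) → w r t = v r t) ∧
      Queues (G j) v := by
  cases h with
  | static hG => cases hG
  | transit hpq hw hb h => exact ⟨hpq, _, hw, hb, h⟩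

/-- No intermediate construct occurs under a recursion, so only the static case arises. -/
theorem unfold {H : GType P A} (h : Queues (.mu H) w) : Queues (GType.subst 0 (.mu H) H) w := by
  cases h with
  | static hG => cases hG with | mu hG => exact .static (hG.subst (.mu hG) 0)

theorem exists_bufStep {H H' : GType P A} {l : CommAction P A} (hs : H.Step l H')
    (h : Queues H w) : ∃ w', BufStep w l w' ∧ Queues H' w' := by
  classical
  induction hs generalizing w with
  | gr1 p q I G j =>
    obtain ⟨hpq, -, hw, h⟩ := h.comm_inv
    let w' : P → P → List A := fun r t => if (r, t) = (p, q) then [j.1] else w r t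
    have hw' : w' p q = [j.1] := if_pos rfl
    have hb : ∀ r t, (r, t) ≠ (p, q) → w' r t = w r t := fun r t hrt => if_neg hrt
    exact ⟨w', .send (by rw [hw', hw]; rfl) hb, .transit hpq (by rw [hw', hw]) hb (h j)⟩
  | gr2 p q I j G =>
    obtain ⟨-, v, hw, hb, h⟩ := h.transit_inv
    exact ⟨v, .recv hw fun r t hrt => (hb r t hrt).symm, h⟩
  | gr3 _ ih => exact ih h.unfold
  | @gr4 p q I G G' l _ hp hq ih =>
    obtain ⟨hpq, hI, hw, h⟩ := h.comm_inv
    choose v hv hG' using fun i => ih i (h i)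
    obtain ⟨a, ha⟩ := hI
    refine ⟨v ⟨a, ha⟩, hv _, .comm hpq ⟨a, ha⟩ ((hv ⟨a, ha⟩).apply_of_ne hp hq |>.trans hw) ?_⟩
    intro i
    -- The label determines the new buffers, so all branches agree on them.
    rw [(hv ⟨a, ha⟩).deterministic (hv i)]
    exact hG' i
  | @gr5 p q I j G G' l _ hq _ ih =>
    obtain ⟨hpq, v, hw, hb, h⟩ := h.transit_inv
    obtain ⟨v', hv, hG'⟩ := ih h
    let w' : P → P → List A := fun r t => if (r, t) = (p, q) then j.1 :: v' r t else v' r t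
    have hw' : w' p q = j.1 :: v' p q := if_pos rfl
    have hb' : ∀ r t, (r, t) ≠ (p, q) → w' r t = v' r t := fun r t hrt => if_neg hrt
    refine ⟨w', ?_, .transit hpq hw' hb' hG'⟩
    cases hv with
    | @send _ p' q' a hs ho =>
      refine .send ?_ fun r t hrt => ?_
      · by_cases e : (p', q') = (p, q)
        -- A further send on the same channel queues behind the pending message `j`.
        · cases e
          rw [hw', hw, hs]
          rfl
        · rw [hb' _ _ e, hb _ _ e, hs]
      · by_cases e : (r, t) = (p, q)
        · cases e
          rw [hw', hw, ho _ _ hrt]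
        · rw [hb' _ _ e, hb _ _ e, ho _ _ hrt]
    | @recv _ p' q' a hs ho =>
      refine .recv ?_ fun r t hrt => ?_
      -- A receive on this channel would have `q` as its subject, which (GR5) excludes.
      · have e : (p', q') ≠ (p, q) := fun e => hq (Prod.ext_iff.1 e).2.symm
        rw [hb' _ _ e, hb _ _ e, hs]
      · by_cases e : (r, t) = (p, q)
        · cases e
          rw [hw', hw, ho _ _ hrt]
        · rw [hb' _ _ e, hb _ _ e, ho _ _ hrt]

/-- A nonempty channel rules out the static case. The constructs passed on the way down do not
involve `q` as a sender or receiver still to act, since `q` is ready to receive from `p`; the first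
intermediate construct with receiver `q` thus carries the head of the queue. -/
theorem exists_step_recv {H : GType P A} {a : A} {u : List A} {T U : LType P A}
    (h : Queues H w) (hw : w p q = a :: u) (hH : RunProj H q T)
    (hT : T.Step q (.recv p q a) U) : ∃ H', H.Step (.recv p q a) H' := by
  classical
  induction h with
  | static => cases hw
  | @comm p' q' I G w hpq hI hw' h ih =>
    by_cases hp : q = p'
    · subst hp
      obtain ⟨S, hS, -⟩ := hH.sender_inv
      cases hT.unfolds hS
    by_cases hq : q = q'
    · subst hq
      obtain ⟨L, S, hL, hS, -⟩ := hH.receiver_inv hp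
      cases hT.unfolds hS
      -- The step forces `p = p'`, but this channel is empty while the communication is still to
      -- come.
      rw [hw'] at hw
      cases hw
    · choose H' h using fun i => ih i hw (hH.other_inv hp hq i)
      exact ⟨_, .gr4 h (Ne.symm hp) (Ne.symm hq)⟩
  | @transit p' q' I j G w w' hpq hw' hb h ih =>
    by_cases hq : q = q'
    · subst hq
      obtain ⟨L, S, hj, hS, -⟩ := hH.transit_receiver_inv
      cases hT.unfolds hS
      rw [hw'] at hw
      rw [← (List.cons.inj hw).1]
      exact ⟨_, .gr2 _ _ _ _ _⟩
    · have e : (p, q) ≠ (p', q') := fun e => hq (Prod.ext_iff.1 e).2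
      obtain ⟨H', h⟩ := ih ((hb _ _ e).symm.trans hw) (hH.transit_other_inv hq)
      exact ⟨_, .gr5 (G' := Function.update G j H') (by simpa using h) (Ne.symm hq)
        fun i hi => by simp [hi]⟩

end Queues

/-! ### The bisimulation -/

/-- A global transition is matched by a transition of the type of its subject. -/
theorem RunProj.exists_step {P A : Type*} {H H' : GType P A} {l : CommAction P A}
    {T : LType P A} {w : P → P → List A} (hs : H.Step l H') (hw : Queues H w)
    (h : RunProj H l.subj T) : ∃ U, T.Step l.subj l U ∧ RunProj H' l.subj U := by
  induction hs generalizing T w with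
  | gr1 p q I G j =>
    obtain ⟨hpq, -⟩ := hw.comm_inv
    obtain ⟨S, hT, h⟩ := sender_inv (p := p) h
    exact ⟨S j, .of_unfolds hT (.lr1 _ _ _ j), .transit_other hpq (h j)⟩
  | gr2 p q I j G =>
    obtain ⟨L, S, hj, hT, h⟩ := transit_receiver_inv (q := q) h
    exact ⟨_, .of_unfolds hT (.lr2 _ _ _ ⟨j.1, hj⟩), h⟩
  | gr3 _ ih => exact ih hw.unfold h.unfold_global
  | gr4 _ hp hq ih =>
    obtain ⟨-, ⟨a, ha⟩, -, hw⟩ := hw.comm_inv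
    choose U hU hG' using fun i => ih i (hw i) (h.other_inv hp.symm hq.symm i)
    refine ⟨U ⟨a, ha⟩, hU _, .other hp.symm hq.symm fun i => ?_⟩
    -- The branches share the type `T`, and determinism gives them a common successor.
    rw [(hU ⟨a, ha⟩).deterministic (hU i)]
    exact hG' i
  | gr5 _ hq _ ih =>
    obtain ⟨-, v, -, -, hw⟩ := hw.transit_inv
    obtain ⟨U, hU, hG'⟩ := ih hw (h.transit_other_inv hq.symm)
    exact ⟨U, hU, .transit_other hq.symm hG'⟩

/-- The configuration `s` implements the global state `G`. -/
structure Implements {P A : Type*} (G : GType P A) (s : Config P A) : Prop where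
  proj (r : P) : RunProj G r (s.types r)
  queues : Queues G s.buf

namespace Implements

variable {P A : Type*} {G : GType P A} {s : Config P A} {l : CommAction P A}

theorem exists_config_step {G' : GType P A} (h : Implements G s) (hs : G.Step l G') :
    ∃ s', Config.Step s l s' ∧ Implements G' s' := by
  classical
  obtain ⟨w, hw, hq⟩ := h.queues.exists_bufStep hs
  obtain ⟨U, hU, hp⟩ := RunProj.exists_step hs h.queues (h.proj l.subj)
  refine ⟨⟨Function.update s.types l.subj U, w⟩, Config.step_iff.2 ⟨by simpa using hU, ?_, hw⟩,
    fun r => ?_, hq⟩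
  · intro r hr
    simp [hr]
  · by_cases hr : r = l.subj
    · subst hr
      simpa using hp
    · simpa [hr] using (h.proj r).step_of_ne hs hr

/-- Once `G` can perform the label, its move is matched by some move of `s`, which determinism
identifies with the given one. -/
theorem exists_global_step {s' : Config P A} (h : Implements G s) (hs : Config.Step s l s') :
    ∃ G', G.Step l G' ∧ Implements G' s' := by
  obtain ⟨G', hG'⟩ : ∃ G', G.Step l G' := by
    cases hs with
    | send hT => exact (h.proj _).exists_step_send hT
    | recv hT _ hw => exact h.queues.exists_step_recv hw (h.proj _) hT
  obtain ⟨t, ht, h'⟩ := h.exists_config_step hG'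
  rw [ht.deterministic hs] at h'
  exact ⟨G', hG', h'⟩

theorem mem_traces_iff (h : Implements G s) (φ : List (CommAction P A)) :
    φ ∈ traces GType.Step G ↔ φ ∈ traces Config.Step s := by
  induction φ generalizing G s with
  | nil => exact ⟨fun _ => ⟨s, .nil s⟩, fun _ => ⟨G, .nil G⟩⟩
  | cons l φ ih =>
    constructor
    · rintro ⟨G'', hr⟩
      cases hr with
      | cons hs hr =>
        obtain ⟨s', hs', h'⟩ := h.exists_config_step hs
        obtain ⟨s'', hr'⟩ := (ih h').1 ⟨_, hr⟩
        exact ⟨s'', .cons hs' hr'⟩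
    · rintro ⟨s'', hr⟩
      cases hr with
      | cons hs hr =>
        obtain ⟨G', hs', h'⟩ := h.exists_global_step hs
        obtain ⟨G'', hr'⟩ := (ih h').2 ⟨_, hr⟩
        exact ⟨G'', .cons hs' hr'⟩

end Implements

theorem mainTheorem1 {P A : Type*} (G : GType P A) (hG : G.IsGlobal)
    (T : P → LType P A) (hT : ∀ p, Proj G p (T p)) :
    ∀ φ : List (CommAction P A),
      φ ∈ traces GType.Step G ↔
        φ ∈ traces Config.Step (Config.mk T (fun _ _ => [])) :=
  Implements.mem_traces_iff
    ⟨fun r => .weak (.of_proj (hT r)), .static hG.isStatic⟩
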